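/- Let $M$ be a connected smooth manifold without boundary, of finite dimension $d$, with a smooth Riemannian metric $g$ and Riemannian distance $d(\cdot,\cdot)$ (the infimum of the lengths of $C^1$ curves joining two points), and suppose that $M$ is complete, i.e. $(M,d)$ is a complete metric space. Let $\mu$ be a Borel probability measure on $M$ with compact support which has a density with respect to the Riemannian volume: there is a Borel function $h\colon M\to[0,\infty]$ such that $d\mu = h\,\sqrt{\det(g_{ij})}\,dy^1\cdots dy^d$ in local coordinates. Let $n\ge 1$ be an integer and let $p>0$ be a real number. Then for every $(a_1,\dots,a_n)\in M^n$ the function $x\mapsto \min_{1\le i\le n} d(x,a_i)^p$ is $\mu$-integrable, and the distortion function $$F_{n,p}\colon M^n\to[0,\infty),\qquad F_{n,p}(a_1,\dots,a_n)=\int_M \min_{1\le i\le n} d(x,a_i)^p\,\mu(dx),$$ is continuous on $M^n$ and attains a minimum: there is $(a_1,\dots,a_n)\in M^n$ with $F_{n,p}(a_1,\dots,a_n)\le F_{n,p}(b_1,\dots,b_n)$ for all $(b_1,\dots,b_n)\in M^n$. -/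

import Mathlib

open MeasureTheory Bundle
open scoped Manifold ContDiff ENNReal

noncomputable section

section Density

variable {d : ℕ} {M : Type*} [TopologicalSpace M] [ChartedSpace (EuclideanSpace ℝ (Fin d)) M]
  [RiemannianBundle (fun x : M => TangentSpace (𝓡 d) x)]

/-- The `i`-th coordinate vector field `∂ᵢ` of the chart `e`, at the point of `M` with
coordinates `y`. -/
def coordVector (e : OpenPartialHomeomorph M (EuclideanSpace ℝ (Fin d)))
    (y : EuclideanSpace ℝ (Fin d)) (i : Fin d) : TangentSpace (𝓡 d) (e.symm y) :=
  mfderiv (𝓡 d) (𝓡 d) e.symm y (EuclideanSpace.single i (1 : ℝ))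

/-- The matrix `gᵢⱼ = ⟨∂ᵢ, ∂ⱼ⟩` of the Riemannian metric in the chart `e`, at the point of `M`
with coordinates `y`. -/
def metricMatrix (e : OpenPartialHomeomorph M (EuclideanSpace ℝ (Fin d)))
    (y : EuclideanSpace ℝ (Fin d)) : Matrix (Fin d) (Fin d) ℝ :=
  Matrix.of fun i j => inner ℝ (coordVector e y i) (coordVector e y j)

/-- The measure `μ` has density `h` with respect to the Riemannian volume: in each chart of the
atlas, `dμ = h √(det gᵢⱼ) dy¹ ⋯ dyᵈ`. -/
def HasRiemannianDensity [MeasurableSpace M] (μ : Measure M) (h : M → ℝ≥0∞) : Prop :=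
  Measurable h ∧
    ∀ e ∈ atlas (EuclideanSpace ℝ (Fin d)) M, ∀ A : Set M, A ⊆ e.source → MeasurableSet A →
      μ A = ∫⁻ y in e '' A, h (e.symm y) * ENNReal.ofReal (Real.sqrt (metricMatrix e y).det)

end Density

/-- The distortion function of order `p` of `μ`:
`F(a₁, …, aₙ) = ∫ min_{1 ≤ i ≤ n} d(x, aᵢ) ^ p dμ(x)`. -/
def distortion {M : Type*} [MetricSpace M] [MeasurableSpace M] (μ : Measure M) (n : ℕ) (p : ℝ)
    (a : Fin n → M) : ℝ :=
  ∫ x, (⨅ i, dist x (a i) ^ p) ∂μ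

end

/-!
The argument has a geometric half and a soft half.

*Geometry.* The Riemannian distance is an infimum of lengths of paths, so a point `y` can be
approached from `x` through a point at any prescribed distance `r ≤ dist x y` from `x`, at
arbitrarily small extra cost (`hasApproxIntermediatePoints_of_isRiemannianManifold`). In a complete
locally compact metric space with this property the set of radii `r` for which `closedBall x r` is
compact is open and closed in `[0, ∞)`, hence closed balls are compact: this is the part of the
Hopf–Rinow–Cohn-Vossen theorem that is needed (`HasApproxIntermediatePoints.properSpace`). In
particular a connected complete Riemannian manifold is second countable, so `μ` is carried by its
support.

*Minimization.* The integrand `min dist x (a i) ^ p` is jointly continuous in `(a, x)` and `μ` lives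
on a compact set, which gives integrability and continuity of the distortion. If the support lies
in `closedBall x₀ r`, a centre at distance more than `2 * r` from `x₀` is farther from each point of
the support than `x₀` is, so moving it to `x₀` does not increase the distortion
(`iInf_dist_rpow_replace_le`). Hence a minimizer over the compact set `(closedBall x₀ (2 * r))ⁿ` is
a global one.
-/

open Set Metric Filter Topology Manifold

/-! ### Complete locally compact length spaces are proper -/

section Proper

variable {X : Type*} [MetricSpace X]

/-- The approximate form of the existence of geodesics; any length space satisfies it. The point
`z` lies at the prescribed distance `r` from `x`, and is nearly on a shortest path to `y`. -/
def HasApproxIntermediatePoints (X : Type*) [MetricSpace X] : Prop :=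
  ∀ (x y : X) (r ε : ℝ), 0 ≤ r → r ≤ dist x y → 0 < ε →
    ∃ z, dist x z = r ∧ dist z y < dist x y - r + ε

lemma HasApproxIntermediatePoints.closedBall_subset_thickening
    (h : HasApproxIntermediatePoints X) (x : X) {r s δ : ℝ} (hr : 0 ≤ r) (hδ : 0 < δ)
    (hs : s < r + δ) : closedBall x s ⊆ thickening δ (closedBall x r) := by
  intro y hy
  rw [mem_thickening_iff]
  rcases le_total (dist x y) r with hxy | hxy
  · exact ⟨y, by rwa [mem_closedBall, dist_comm], by simpa using hδ⟩
  · obtain ⟨z, hz, hzy⟩ := h x y r (r + δ - s) hr hxy (by linarith)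
    rw [mem_closedBall, dist_comm] at hy
    refine ⟨z, by rw [mem_closedBall, dist_comm, hz], ?_⟩
    rw [dist_comm]
    linarith

/-- Compactness of closed balls passes to limits of radii: a closed ball which, for every `δ > 0`,
lies in the `δ`-thickening of a compact ball is totally bounded. -/
lemma HasApproxIntermediatePoints.isCompact_closedBall_of_mem_closure [CompleteSpace X]
    (h : HasApproxIntermediatePoints X) (x : X) {r : ℝ}
    (hr : r ∈ closure {s : ℝ | 0 ≤ s ∧ IsCompact (closedBall x s)}) :
    IsCompact (closedBall x r) := by
  refine isCompact_iff_totallyBounded_isComplete.2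
    ⟨totallyBounded_iff.2 fun ε hε => ?_, isClosed_closedBall.isComplete⟩
  obtain ⟨s, ⟨hs, hsc⟩, hrs⟩ := Metric.mem_closure_iff.1 hr (ε / 2) (half_pos hε)
  rw [Real.dist_eq] at hrs
  have hsub := h.closedBall_subset_thickening x hs (half_pos hε)
    (show r < s + ε / 2 by linarith [le_abs_self (r - s)])
  obtain ⟨t, htf, ht⟩ := totallyBounded_iff.1 hsc.totallyBounded (ε / 2) (half_pos hε)
  refine ⟨t, htf, fun y hy => ?_⟩
  obtain ⟨z, hz, hyz⟩ := mem_thickening_iff.1 (hsub hy)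
  obtain ⟨w, hw, hzw⟩ := mem_iUnion₂.1 (ht hz)
  refine mem_iUnion₂.2 ⟨w, hw, ?_⟩
  rw [mem_ball] at hzw ⊢
  linarith [dist_triangle y z w]

/-- If a closed ball is compact, so is some strictly larger concentric one. -/
lemma HasApproxIntermediatePoints.exists_isCompact_closedBall_gt [LocallyCompactSpace X]
    (h : HasApproxIntermediatePoints X) (x : X) {r : ℝ} (hr : 0 ≤ r)
    (hc : IsCompact (closedBall x r)) :
    ∃ δ > 0, IsCompact (closedBall x (r + δ)) := by
  obtain ⟨δ, hδ, hδc⟩ := hc.exists_isCompact_cthickening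
  refine ⟨δ / 2, half_pos hδ, hδc.of_isClosed_subset isClosed_closedBall ?_⟩
  exact (h.closedBall_subset_thickening x hr hδ (by linarith)).trans
    (thickening_subset_cthickening _ _)

/-- The Hopf–Rinow–Cohn-Vossen theorem: complete locally compact length spaces are proper. -/
theorem HasApproxIntermediatePoints.properSpace [CompleteSpace X] [LocallyCompactSpace X]
    (h : HasApproxIntermediatePoints X) : ProperSpace X := by
  refine ProperSpace.of_isCompact_closedBall_of_le 0 fun x b hb => ?_
  let S : Set ℝ := {s : ℝ | 0 ≤ s ∧ IsCompact (closedBall x s)}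
  have hS : IsClosed S := isClosed_of_closure_subset fun s hs =>
    ⟨closure_minimal (fun _ hu => hu.1) isClosed_Ici hs,
      h.isCompact_closedBall_of_mem_closure x hs⟩
  have hsub : Icc 0 b ⊆ S := by
    refine (hS.inter isClosed_Icc).Icc_subset_of_forall_exists_gt
      ⟨le_rfl, by simp⟩ ?_
    rintro s ⟨⟨hs, hsc⟩, -⟩ u (hu : s < u)
    obtain ⟨δ, hδ, hδc⟩ := h.exists_isCompact_closedBall_gt x hs hsc
    have hlt : s < min u (s + δ) := lt_min hu (by linarith)
    exact ⟨min u (s + δ), ⟨hs.trans hlt.le, hδc.of_isClosed_subset isClosed_closedBall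
      (closedBall_subset_closedBall (min_le_right _ _))⟩, hlt, min_le_left _ _⟩
  exact (hsub ⟨hb, le_rfl⟩).2

end Proper

/-! ### Riemannian manifolds are length spaces -/

section Riemannian

/-- On a nearly shortest path from `x` to `y`, take a point at distance `r` from `x`: the length of
the path up to this point is at least `r`, which bounds the length of the rest. -/
theorem hasApproxIntermediatePoints_of_isRiemannianManifold {E H M : Type*}
    [NormedAddCommGroup E] [NormedSpace ℝ E] [TopologicalSpace H] (I : ModelWithCorners ℝ E H)
    [MetricSpace M] [ChartedSpace H M] [RiemannianBundle (fun x : M => TangentSpace I x)]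
    [IsRiemannianManifold I M] : HasApproxIntermediatePoints M := by
  intro x y r ε hr hxy hε
  have hlt : riemannianEDist I x y < ENNReal.ofReal (dist x y + ε) := by
    rw [← IsRiemannianManifold.out (I := I) x y, edist_dist]
    exact (ENNReal.ofReal_lt_ofReal_iff (by linarith)).2 (by linarith)
  obtain ⟨γ, h0, h1, hγ, hlen⟩ := exists_lt_of_riemannianEDist_lt hlt
  have hcont : ContinuousOn (fun t => dist x (γ t)) (Icc 0 1) :=
    (continuous_const.dist continuous_id).comp_continuousOn hγ.continuousOn
  obtain ⟨t, ht, hxt⟩ : r ∈ (fun t => dist x (γ t)) '' Icc 0 1 :=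
    intermediate_value_Icc zero_le_one hcont (by simpa [h0, h1] using ⟨hr, hxy⟩)
  have hxt : dist x (γ t) = r := hxt
  refine ⟨γ t, hxt, ?_⟩
  have hfst : edist x (γ t) ≤ pathELength I γ 0 t := by
    rw [IsRiemannianManifold.out (I := I)]
    exact riemannianEDist_le_pathELength (hγ.mono (Icc_subset_Icc_right ht.2)) h0 rfl ht.1
  have hsnd : edist (γ t) y ≤ pathELength I γ t 1 := by
    rw [IsRiemannianManifold.out (I := I)]
    exact riemannianEDist_le_pathELength (hγ.mono (Icc_subset_Icc_left ht.1)) rfl h1 ht.2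
  have hsum : edist x (γ t) + edist (γ t) y < ENNReal.ofReal (dist x y + ε) :=
    ((add_le_add hfst hsnd).trans_eq (pathELength_add ht.1 ht.2)).trans_lt hlen
  rw [edist_dist, edist_dist, ← ENNReal.ofReal_add dist_nonneg dist_nonneg,
    ENNReal.ofReal_lt_ofReal_iff (by linarith), hxt] at hsum
  linarith

end Riemannian

/-! ### The distortion of a compactly supported measure on a proper space -/

section Distortion

variable {X : Type*} [MetricSpace X]

lemma continuous_iInf_dist_rpow (n : ℕ) {p : ℝ} (hp : 0 < p) :
    Continuous fun q : (Fin n → X) × X => ⨅ i, dist q.2 (q.1 i) ^ p := by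
  rcases isEmpty_or_nonempty (Fin n) with hn | hn
  · simp only [Real.iInf_of_isEmpty]
    exact continuous_const
  · simp only [← Finset.inf'_univ_eq_ciInf]
    refine Continuous.finset_inf'_apply _ fun i _ => ?_
    exact (by fun_prop : Continuous fun q : (Fin n → X) × X => dist q.2 (q.1 i)).rpow_const
      fun _ => Or.inr hp.le

/-- Moving the centres outside `closedBall x₀ (2 * r)` to `x₀` does not increase the integrand at
points of `closedBall x₀ r`. -/
lemma iInf_dist_rpow_replace_le {n : ℕ} {p : ℝ} (hp : 0 < p) {x₀ x : X} {r : ℝ}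
    (hx : x ∈ closedBall x₀ r) {a b : Fin n → X}
    (hab : ∀ i, b i = a i ∨ (b i = x₀ ∧ a i ∉ closedBall x₀ (2 * r))) :
    (⨅ i, dist x (b i) ^ p) ≤ ⨅ i, dist x (a i) ^ p := by
  refine ciInf_mono ⟨0, ?_⟩ fun i => Real.rpow_le_rpow dist_nonneg ?_ hp.le
  · rintro _ ⟨i, rfl⟩
    positivity
  · rcases hab i with h | ⟨h, hi⟩
    · rw [h]
    · rw [mem_closedBall] at hx hi
      rw [h]
      linarith [dist_triangle_left (a i) x₀ x]

variable [ProperSpace X] [MeasurableSpace X]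

lemma restrict_support_eq_self (μ : Measure X) : μ.restrict μ.support = μ :=
  Measure.restrict_eq_self_of_ae_mem μ.support_mem_ae

variable [BorelSpace X]

lemma integrable_of_continuous_of_isCompact_support {μ : Measure X} [IsFiniteMeasure μ]
    (hμ : IsCompact μ.support) {f : X → ℝ} (hf : Continuous f) : Integrable f μ := by
  rw [← restrict_support_eq_self μ]
  exact hf.continuousOn.integrableOn_compact hμ

lemma continuous_distortion {μ : Measure X} [IsFiniteMeasure μ] (hμ : IsCompact μ.support)
    (n : ℕ) {p : ℝ} (hp : 0 < p) : Continuous (distortion μ n p) := by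
  have h := continuous_parametric_integral_of_continuous (μ := μ)
    (f := fun (a : Fin n → X) (x : X) => ⨅ i, dist x (a i) ^ p)
    (continuous_iInf_dist_rpow n hp) hμ
  rwa [restrict_support_eq_self μ] at h

lemma integrable_iInf_dist_rpow {μ : Measure X} [IsFiniteMeasure μ] (hμ : IsCompact μ.support)
    {n : ℕ} {p : ℝ} (hp : 0 < p) (a : Fin n → X) :
    Integrable (fun x => ⨅ i, dist x (a i) ^ p) μ :=
  integrable_of_continuous_of_isCompact_support hμ
    ((continuous_iInf_dist_rpow n hp).comp (Continuous.prodMk_right a))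

open Classical in
theorem exists_forall_distortion_le [Nonempty X] {μ : Measure X} [IsFiniteMeasure μ]
    (hμ : IsCompact μ.support) (n : ℕ) {p : ℝ} (hp : 0 < p) :
    ∃ a : Fin n → X, ∀ b : Fin n → X, distortion μ n p a ≤ distortion μ n p b := by
  obtain ⟨x₀⟩ := ‹Nonempty X›
  -- The radius is taken positive so that `x₀` itself is an admissible centre.
  obtain ⟨r, hr, hsupp⟩ := hμ.isBounded.subset_closedBall_lt 0 x₀
  obtain ⟨a, -, ha⟩ := (isCompact_univ_pi fun _ : Fin n =>
    isCompact_closedBall x₀ (2 * r)).exists_isMinOn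
      ⟨fun _ => x₀, fun _ _ => mem_closedBall_self (by positivity)⟩
      (continuous_distortion hμ n hp).continuousOn
  refine ⟨a, fun b => ?_⟩
  let b' : Fin n → X := fun i => if b i ∈ closedBall x₀ (2 * r) then b i else x₀
  have hb' : b' ∈ univ.pi fun _ : Fin n => closedBall x₀ (2 * r) := by
    intro i _
    by_cases hi : b i ∈ closedBall x₀ (2 * r)
    · simpa only [b', if_pos hi] using hi
    · simpa only [b', if_neg hi] using mem_closedBall_self (by positivity)
  refine (ha hb').trans (integral_mono_ae (integrable_iInf_dist_rpow hμ hp b')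
    (integrable_iInf_dist_rpow hμ hp b) ?_)
  filter_upwards [μ.support_mem_ae] with x hx
  refine iInf_dist_rpow_replace_le hp (hsupp hx) fun i => ?_
  by_cases hi : b i ∈ closedBall x₀ (2 * r)
  · exact Or.inl (if_pos hi)
  · exact Or.inr ⟨if_neg hi, hi⟩

end Distortion

theorem mainTheorem1 {d : ℕ} {M : Type*} [MetricSpace M]
    [ChartedSpace (EuclideanSpace ℝ (Fin d)) M] [IsManifold (𝓡 d) ∞ M]
    [RiemannianBundle (fun x : M => TangentSpace (𝓡 d) x)]
    [IsContMDiffRiemannianBundle (𝓡 d) ∞ (EuclideanSpace ℝ (Fin d))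
      (fun x : M => TangentSpace (𝓡 d) x)]
    [IsRiemannianManifold (𝓡 d) M] [CompleteSpace M]
    [MeasurableSpace M] [BorelSpace M]
    (μ : Measure M) [IsProbabilityMeasure μ]
    (hdensity : ∃ h : M → ℝ≥0∞, HasRiemannianDensity (d := d) μ h)
    (hsupport : IsCompact μ.support)
    (n : ℕ) (hn : 1 ≤ n) (p : ℝ) (hp : 0 < p) :
    (∀ a : Fin n → M, Integrable (fun x => ⨅ i, dist x (a i) ^ p) μ) ∧
      Continuous (distortion μ n p) ∧
      ∃ a : Fin n → M, ∀ b : Fin n → M, distortion μ n p a ≤ distortion μ n p b := by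
  have : LocallyCompactSpace M := ChartedSpace.locallyCompactSpace (EuclideanSpace ℝ (Fin d)) M
  have : ProperSpace M :=
    (hasApproxIntermediatePoints_of_isRiemannianManifold (𝓡 d)).properSpace
  have : Nonempty M := μ.nonempty_of_neZero
  exact ⟨integrable_iInf_dist_rpow hsupport hp, continuous_distortion hsupport n hp,
    exists_forall_distortion_le hsupport n hp⟩
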